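/- Let $n\ge 2$ and $1\le k\le n$, and write $\sigma_j$ for the $j$-th elementary symmetric function ($\sigma_0=1$); for a symmetric matrix $A$, $\sigma_k(A)$ is $\sigma_k$ of its eigenvalues. There is a function $C:\mathbb{R}^2\to(0,\infty)$, depending only on $n$ and $k$, with the following property. Let $\Omega\subset\mathbb{R}^n$ be a bounded open set whose boundary is starshaped with respect to the origin, i.e. $\Gamma:=\partial\Omega=\{\rho(\theta)\theta:\theta\in\mathbb{S}^{n-1}\}$ with $\rho:\mathbb{S}^{n-1}\to(0,\infty)$ of class $C^2$, and suppose that $\Gamma$ is $(k-1)$-convex: at every point its principal curvature vector $\kappa\in\mathbb{R}^{n-1}$ (with the sign convention that spheres have positive curvatures) satisfies $\sigma_j(\kappa)>0$ for $1\le j\le k-1$. In polar coordinates $x=r\theta$ on $\mathbb{R}^n\setminus\{0\}$ set $g(x)=r/\rho(\theta)$ and $\varphi=\varphi_N=g^N$, and put $$c_0=C\big(\min\rho,\|\rho\|_{C^2(\mathbb{S}^{n-1})}\big)>0,\qquad c_1=\min_{\Gamma}\sigma_{k-1}(\kappa).$$ Here $\|\rho\|_{C^2(\mathbb{S}^{n-1})}$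 is the maximum over $\mathbb{S}^{n-1}$ of the sum of the norms of the derivatives of order $0,1,2$ of $x\mapsto\rho(x/|x|)$. Then the minimum $c_1$ is attained and positive, and: 1. For every real $N>0$, $\varphi$ is of class $C^2$ on $\mathbb{R}^n\setminus\{0\}$, $\varphi=1$ on $\partial\Omega$, and on $\mathbb{R}^n\setminus\{0\}$ $$\sigma_k(D^2\varphi)\ \ge\ \frac{N^k g^{kN-k}}{r^k}\left(-c_0+\frac{c_1(N-1)}{\rho}\right).$$ 2. $g\ge 1$ on $\mathbb{R}^n\setminus\Omega$, and there is $N_0=N_0(\Omega)>0$ such that for all real $N\ge N_0$ $$\sigma_k(D^2\varphi)\ \ge\ r^{-k}\quad\text{on }\mathbb{R}^n\setminus\overline\Omega .$$ -/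

import Mathlib

open scoped Manifold ContDiff

namespace StarshapedHessian

noncomputable section

/-- Euclidean space `ℝⁿ` with `n = m + 1`. -/
abbrev E (m : ℕ) : Type := EuclideanSpace ℝ (Fin (m + 1))

/-- The unit sphere `𝕊ᵐ` of `ℝᵐ⁺¹`. -/
abbrev S (m : ℕ) : Type := Metric.sphere (0 : E m) 1

instance factFinrank (m : ℕ) : Fact (Module.finrank ℝ (E m) = m + 1) :=
  ⟨finrank_euclideanSpace_fin⟩

/-- The function `x ↦ f (x / |x|)` on `ℝⁿ ∖ {0}` (with the irrelevant value `0` at the origin). -/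
def radialExt {m : ℕ} (f : S m → ℝ) (x : E m) : ℝ :=
  open Classical in
  if h : x = 0 then 0 else
    f ⟨‖x‖⁻¹ • x, by
      rw [mem_sphere_zero_iff_norm, norm_smul, norm_inv, norm_norm,
        inv_mul_cancel₀ (norm_ne_zero_iff.mpr h)]⟩

/-- `Ω` is a bounded open set whose boundary is the radial graph `{ρ(θ) θ : θ ∈ 𝕊ᵐ}` of a
positive function `ρ` of class `C²` on the sphere. -/
structure IsStarshapedDomain {m : ℕ} (Ω : Set (E m)) (ρ : S m → ℝ) : Prop where
  isOpen : IsOpen Ω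
  isBounded : Bornology.IsBounded Ω
  contMDiff : ContMDiff (𝓡 m) 𝓘(ℝ, ℝ) 2 ρ
  pos : ∀ θ, 0 < ρ θ
  frontier_eq : frontier Ω = Set.range fun θ : S m => ρ θ • (θ : E m)

/-- The radial embedding `θ ↦ ρ(θ) θ` of the sphere, extended as a function homogeneous of degree
`0`. For `θ` in the sphere, `u ↦ radialEmb ρ (θ + u)`, with `u` in the hyperplane orthogonal
to `θ`, is a local parametrization of the radial graph of `ρ` near the point `ρ(θ) θ`. -/
def radialEmb {m : ℕ} (ρ : S m → ℝ) (x : E m) : E m :=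
  radialExt ρ x • (‖x‖⁻¹ • x)

/-- The first fundamental form of the radial graph of `ρ` at `ρ(θ) θ`, evaluated on vectors
`u, v` orthogonal to `θ` (coordinate vectors of the parametrization `u ↦ radialEmb ρ (θ + u)`). -/
def firstForm {m : ℕ} (ρ : S m → ℝ) (θ : S m) (u v : E m) : ℝ :=
  inner ℝ (fderiv ℝ (radialEmb ρ) (θ : E m) u) (fderiv ℝ (radialEmb ρ) (θ : E m) v)

/-- `ν` is the outward unit normal of the radial graph of `ρ` at `ρ(θ) θ`. -/
def IsOutwardUnitNormal {m : ℕ} (ρ : S m → ℝ) (θ : S m) (ν : E m) : Prop :=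
  ‖ν‖ = 1 ∧
  (∀ u : E m, inner ℝ (θ : E m) u = 0 →
    inner ℝ (fderiv ℝ (radialEmb ρ) (θ : E m) u) ν = 0) ∧
  0 < inner ℝ (θ : E m) ν

/-- The second fundamental form `h(u, v) = -⟨∂ᵤ∂ᵥX, ν⟩` of the radial graph of `ρ` at `ρ(θ) θ`
(positive for round spheres when `ν` is the outward unit normal), on vectors `u, v` orthogonal
to `θ`. -/
def secondForm {m : ℕ} (ρ : S m → ℝ) (θ : S m) (ν u v : E m) : ℝ :=
  -inner ℝ (fderiv ℝ (fderiv ℝ (radialEmb ρ)) (θ : E m) u v) ν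

/-- `κ = (κ₁, …, κₘ)` is the vector of principal curvatures (with multiplicity, in some order) of
the radial graph of `ρ` at `ρ(θ) θ`: there are `m` tangent vectors that are orthonormal for the
first fundamental form (hence a basis of the `m`-dimensional tangent space) and that
diagonalize the second fundamental form, with diagonal entries `κᵢ`. -/
def IsPrincipalCurvatures {m : ℕ} (ρ : S m → ℝ) (θ : S m) (κ : Fin m → ℝ) : Prop :=
  ∃ (ν : E m) (u : Fin m → E m), IsOutwardUnitNormal ρ θ ν ∧
    (∀ i, inner ℝ (θ : E m) (u i) = 0) ∧
    (∀ i j, firstForm ρ θ (u i) (u j) = if i = j then 1 else 0) ∧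
    (∀ i j, secondForm ρ θ ν (u i) (u j) = if i = j then κ i else 0)

/-- The `j`-th elementary symmetric function of the components of a vector. -/
def sigmaVec {m : ℕ} (j : ℕ) (κ : Fin m → ℝ) : ℝ :=
  (Finset.univ.val.map κ).esymm j

/-- Gårding's cone `Γ_k = {κ : σ_j(κ) > 0, j = 1, …, k}`. -/
def gardingCone (m k : ℕ) : Set (Fin m → ℝ) :=
  {κ | ∀ j, 1 ≤ j → j ≤ k → 0 < sigmaVec j κ}

/-- The radial graph of `ρ` is `k`-convex: at each point, its principal curvature vector belongs
to `Γ_k`. -/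
def IsKConvex {m : ℕ} (k : ℕ) (ρ : S m → ℝ) : Prop :=
  ∀ θ : S m, ∃ κ : Fin m → ℝ, IsPrincipalCurvatures ρ θ κ ∧ κ ∈ gardingCone m k

/-- The Hessian matrix `D²f(x)`. -/
def hessian {m : ℕ} (f : E m → ℝ) (x : E m) : Matrix (Fin (m + 1)) (Fin (m + 1)) ℝ :=
  Matrix.of fun i j => fderiv ℝ (fderiv ℝ f) x
    (EuclideanSpace.single i (1 : ℝ)) (EuclideanSpace.single j (1 : ℝ))

/-- `σ_k(A)` for a symmetric real matrix `A`: the `k`-th elementary symmetric function of its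
eigenvalues, counted with multiplicity. -/
def sigmaMat {m : ℕ} (k : ℕ) (A : Matrix (Fin m) (Fin m) ℝ) : ℝ :=
  A.charpoly.roots.esymm k

/-- A `C²` norm of a function `f` on the sphere: the maximum over the sphere of the sum of the
norms of the derivatives of order `0, 1, 2` of the extension `x ↦ f (x / |x|)`. -/
def c2Norm {m : ℕ} (f : S m → ℝ) : ℝ :=
  ⨆ θ : S m, (|f θ| + ‖fderiv ℝ (radialExt f) (θ : E m)‖ +
    ‖fderiv ℝ (fderiv ℝ (radialExt f)) (θ : E m)‖)

/-- `g = r / ρ(θ)` in polar coordinates `x = r θ`. -/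
def gauge {m : ℕ} (ρ : S m → ℝ) (x : E m) : ℝ :=
  ‖x‖ / radialExt ρ x

/-- `φ = g ^ N`. -/
def phi {m : ℕ} (ρ : S m → ℝ) (N : ℝ) (x : E m) : ℝ :=
  gauge ρ x ^ N

end

end StarshapedHessian

/-! The function `g` is positively homogeneous of degree 1, so at x = rθ one has Dg(x) = Dg(θ),
D²g(x) = D²g(θ)/r and 1/g(x) = ρ(θ)/r. With p = Dg(θ) the chain rule then gives D²φ = (N g^(N-1)/r)
(D²g(θ) + (N-1)ρ p⊗p), which reduces everything to a rank one perturbation on the compact sphere.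

Adding t p⊗p changes σ_k affinely in t, with slope |p|² σ_{k-1} of D²g restricted to the kernel of p
(`sigmaMat_add_rankOne`). This kernel is the tangent space of Γ at ρ(θ)θ, where D²g(θ) is ρ|p| times
the second fundamental form (`IsPrincipalCurvatures.exists_frame`). The slope is thus |p|²
(ρ|p|)^(k-1) σ_{k-1}(κ). Euler's identity p(θ) = 1/ρ forces ρ|p| ≥ 1, so ρ times the slope is at
least c₁/ρ.

The term σ_k(D²g(θ)) is bounded by compactness in terms of min ρ and the C² norm
(`exists_sigma_bounds`). For N < 1 the rank one term has a negative coefficient, so an upper bound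
on the slope is needed as well and enters c₀.

The slope is defined without reference to principal curvatures and is continuous on the sphere;
dividing it by its positive geometric factor shows that σ_{k-1}(κ) attains a minimum. Finally, {g <
1} lies in Ω by connectedness of segments, so g ≥ 1 off Ω, and a large N makes the bracket at least
1. -/

namespace StarshapedHessian

/-! ### Characteristic polynomials and σ_k of symmetric matrices -/

open Polynomial in
-- Symmetry makes the characteristic polynomial split over ℝ, so Vieta's formulas apply. This
-- replaces eigenvalues by a polynomial in the entries.
theorem sigmaMat_eq_coeff {n k : ℕ} {A : Matrix (Fin n) (Fin n) ℝ} (hA : A.IsHermitian)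
    (hk : k ≤ n) : sigmaMat k A = (-1) ^ k * A.charpoly.coeff (n - k) := by
  have hd : A.charpoly.natDegree = n := by simp
  have h := coeff_eq_esymm_roots_of_splits hA.splits_charpoly (k := n - k) (by omega)
  rw [h, hd, A.charpoly_monic.leadingCoeff, Nat.sub_sub_self hk, one_mul, ← mul_assoc, ← mul_pow]
  simp [sigmaMat]

open Polynomial in
theorem charpoly_smul_eq_scaleRoots {n : ℕ} (c : ℝ) (hc : c ≠ 0) (A : Matrix (Fin n) (Fin n) ℝ) :
    (c • A).charpoly = A.charpoly.scaleRoots c := by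
  refine Polynomial.funext fun x => ?_
  obtain ⟨y, rfl⟩ : ∃ y, x = c * y := ⟨c⁻¹ * x, by field_simp⟩
  have h := scaleRoots_eval₂_mul (p := A.charpoly) (RingHom.id ℝ) y c
  simp only [RingHom.id_apply, Matrix.charpoly_natDegree_eq_dim, Fintype.card_fin] at h
  change eval (c * y) _ = _ * eval y _ at h
  rw [h, Matrix.eval_charpoly, Matrix.eval_charpoly]
  have : Matrix.scalar (Fin n) (c * y) - c • A = c • (Matrix.scalar (Fin n) y - A) := by
    ext i j; by_cases hij : i = j <;> simp [hij]; ring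
  rw [this, Matrix.det_smul, Fintype.card_fin]

theorem sigmaMat_smul {n k : ℕ} {A : Matrix (Fin n) (Fin n) ℝ} (hA : A.IsHermitian)
    (hk : k ≤ n) {c : ℝ} (hc : c ≠ 0) : sigmaMat k (c • A) = c ^ k * sigmaMat k A := by
  rw [sigmaMat_eq_coeff hA hk, sigmaMat_eq_coeff (by ext i j; simp [hA.apply i j |>.symm]) hk,
    charpoly_smul_eq_scaleRoots c hc, Polynomial.coeff_scaleRoots,
    Matrix.charpoly_natDegree_eq_dim, Fintype.card_fin, Nat.sub_sub_self hk]
  ring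

/-- The coefficient is a specialization of that of the universal characteristic polynomial, hence
polynomial in the entries. -/
theorem continuous_charpoly_coeff (n j : ℕ) :
    Continuous fun A : Matrix (Fin n) (Fin n) ℝ => A.charpoly.coeff j := by
  have h : (fun A : Matrix (Fin n) (Fin n) ℝ => A.charpoly.coeff j) = fun A =>
      MvPolynomial.eval (fun q : Fin n × Fin n => A q.1 q.2)
        ((Matrix.charpoly.univ ℝ (Fin n)).coeff j) := by
    funext A
    have hA := Matrix.charpoly.univ_map_eval₂Hom (Fin n) (RingHom.id ℝ)
      (fun q : Fin n × Fin n => A q.1 q.2)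
    change _ = A.charpoly at hA
    rw [← hA, Polynomial.coeff_map]
    rfl
  rw [h]
  exact (MvPolynomial.continuous_eval _).comp (by fun_prop)

theorem exists_charpoly_coeff_bound (n j : ℕ) (L : ℝ) :
    ∃ K : ℝ, 0 ≤ K ∧ ∀ A : Matrix (Fin n) (Fin n) ℝ, (∀ a b, |A a b| ≤ L) →
      |A.charpoly.coeff j| ≤ K := by
  have hc : IsCompact (Set.pi Set.univ fun _ : Fin n => Set.pi Set.univ fun _ : Fin n =>
      Set.Icc (-L) L) := isCompact_univ_pi fun _ => isCompact_univ_pi fun _ => isCompact_Icc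
  obtain ⟨K, hK⟩ := hc.exists_bound_of_continuousOn (continuous_charpoly_coeff n j).continuousOn
  exact ⟨max K 0, le_max_right _ _, fun A hA => (hK A fun a _ b _ => abs_le.1 (hA a b)).trans
    (le_max_left _ _)⟩

open Polynomial in
-- Expand along row 0: its minors omit that row, so only the cofactor of the (0,0) entry picks up
-- `s`.
theorem charpoly_add_corner {n : ℕ} {A B : Matrix (Fin (n + 1)) (Fin (n + 1)) ℝ} {s : ℝ}
    (h : ∀ i j, B i j = A i j + if i = 0 ∧ j = 0 then s else 0) :
    B.charpoly = A.charpoly - C s * (A.submatrix Fin.succ Fin.succ).charpoly := by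
  have h1 : ∀ j : Fin (n + 1), (B.charmatrix.submatrix Fin.succ j.succAbove) =
      (A.charmatrix.submatrix Fin.succ j.succAbove) := by
    intro j; ext1 a b
    simp [Matrix.charmatrix_apply, h]
  have h2 : (A.submatrix Fin.succ Fin.succ).charmatrix =
      A.charmatrix.submatrix Fin.succ Fin.succ := by
    ext1 a b
    simp [Matrix.charmatrix_apply, Matrix.diagonal_apply]
  rw [Matrix.charpoly, Matrix.charpoly, Matrix.charpoly, Matrix.det_succ_row_zero,
    Matrix.det_succ_row_zero A.charmatrix, h2, Fin.sum_univ_succ, Fin.sum_univ_succ]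
  simp only [h1, Matrix.charmatrix_apply, h]
  simp
  ring

/-! ### Bilinear forms and rank one perturbations -/

/-- The matrix of a bilinear form in the standard basis. -/
noncomputable def bilinMat {m : ℕ} (T : E m →L[ℝ] E m →L[ℝ] ℝ) :
    Matrix (Fin (m + 1)) (Fin (m + 1)) ℝ :=
  Matrix.of fun i j => T (EuclideanSpace.single i (1 : ℝ)) (EuclideanSpace.single j (1 : ℝ))

theorem charpoly_bilinMat {m : ℕ} (T : E m →L[ℝ] E m →L[ℝ] ℝ)
    (b : OrthonormalBasis (Fin (m + 1)) ℝ (E m)) :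
    (bilinMat T).charpoly = (Matrix.of fun i j => T (b i) (b j)).charpoly := by
  set e := EuclideanSpace.basisFun (Fin (m + 1)) ℝ
  set P := e.toBasis.toMatrix b
  have hP : P * P.transpose = 1 := by
    simpa using e.toMatrix_orthonormalBasis_self_mul_conjTranspose b
  have h : (Matrix.of fun i j => T (b i) (b j)) = P.transpose * bilinMat T * P := by
    ext i j
    have hb : ∀ k, b k = ∑ l, P l k • EuclideanSpace.single l (1 : ℝ) := by
      intro k
      conv_lhs => rw [← e.toBasis.sum_toMatrix_smul_self b k]
      simp [P, e]
    conv_lhs => rw [Matrix.of_apply, hb i, hb j]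
    simp only [map_sum, map_smul, sum_apply, smul_apply,
      Matrix.mul_apply, Matrix.transpose_apply, bilinMat, Matrix.of_apply, smul_eq_mul,
      Finset.sum_mul, Finset.mul_sum]
    refine Finset.sum_congr rfl fun _ _ => Finset.sum_congr rfl fun _ _ => ?_
    ring
  rw [h, Matrix.charpoly_mul_comm, ← mul_assoc, hP, one_mul]

theorem isHermitian_bilinMat {m : ℕ} {T : E m →L[ℝ] E m →L[ℝ] ℝ} (hT : ∀ u v, T u v = T v u) :
    (bilinMat T).IsHermitian := by
  ext i j
  simp [bilinMat, hT (EuclideanSpace.single j 1)]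

theorem abs_bilinMat_le {m : ℕ} (T : E m →L[ℝ] E m →L[ℝ] ℝ) (i j : Fin (m + 1)) :
    |bilinMat T i j| ≤ ‖T‖ := by
  have h := T.le_opNorm₂ (EuclideanSpace.single i (1 : ℝ)) (EuclideanSpace.single j (1 : ℝ))
  simpa [bilinMat] using h

/-- Rank one perturbations act affinely on `σ_k`, with slope the `σ_{k-1}` of the restriction to
the kernel. -/
theorem sigmaMat_add_rankOne {m k : ℕ} (hk : 1 ≤ k) (hkm : k ≤ m + 1)
    {T : E m →L[ℝ] E m →L[ℝ] ℝ} (hT : ∀ u v, T u v = T v u) {p : E m →L[ℝ] ℝ} {ν : E m}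
    {w : Fin m → E m} (hb : Orthonormal ℝ (Fin.cons ν w : Fin (m + 1) → E m))
    (hp : ∀ i, p (w i) = 0) {l : Fin m → ℝ}
    (hl : ∀ i j, T (w i) (w j) = if i = j then l i else 0) (t : ℝ) :
    sigmaMat k (bilinMat (T + t • p.smulRight p)) =
      sigmaMat k (bilinMat T) + t * (p ν ^ 2 * sigmaVec (k - 1) l) := by
  obtain ⟨b, hbe⟩ : ∃ b : OrthonormalBasis (Fin (m + 1)) ℝ (E m), ⇑b = Fin.cons ν w := by
    refine ⟨OrthonormalBasis.mk hb ?_, OrthonormalBasis.coe_mk hb _⟩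
    have h := (basisOfOrthonormalOfCardEqFinrank hb (by simp)).span_eq
    rw [coe_basisOfOrthonormalOfCardEqFinrank] at h
    exact h.ge
  have hT' : ∀ u v, (T + t • p.smulRight p) u v = (T + t • p.smulRight p) v u := by
    intro u v; simp [hT u v, mul_comm]
  rw [sigmaMat_eq_coeff (isHermitian_bilinMat hT) hkm,
    sigmaMat_eq_coeff (isHermitian_bilinMat hT') hkm, charpoly_bilinMat _ b,
    charpoly_bilinMat T b, charpoly_add_corner (s := t * p ν ^ 2)
      (A := Matrix.of fun i j => T (b i) (b j))]
  · have hs : (Matrix.of fun i j => T (b i) (b j)).submatrix Fin.succ Fin.succ =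
        Matrix.diagonal l := by
      ext i j
      simp [hbe, hl, Matrix.diagonal_apply]
    -- The minor has size m rather than m + 1, so the same coefficient index yields σ_{k-1} instead
    -- of σ_k.
    have hc : (Matrix.diagonal l).charpoly.coeff (m + 1 - k) =
        (-1) ^ (k - 1) * sigmaVec (k - 1) l := by
      rw [Matrix.charpoly_diagonal]
      have h := Multiset.prod_X_sub_C_coeff (Finset.univ.val.map l) (k := m + 1 - k)
        (by simp; omega)
      rw [Multiset.map_map] at h
      have hd : m - (m + 1 - k) = k - 1 := by omega
      rw [Multiset.card_map, Finset.card_val, Finset.card_univ, Fintype.card_fin, hd] at h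
      exact h
    rw [hs, Polynomial.coeff_sub, Polynomial.coeff_C_mul, hc]
    obtain ⟨k, rfl⟩ : ∃ j, k = j + 1 := ⟨k - 1, by omega⟩
    have : ((-1 : ℝ) ^ k) * (-1) ^ k = 1 := by rw [← mul_pow]; simp
    simp only [Nat.add_sub_cancel]
    rw [pow_succ]
    linear_combination (t * p ν ^ 2 * sigmaVec k l) * this
  · intro i j
    refine Fin.cases ?_ (fun i => ?_) i <;> refine Fin.cases ?_ (fun j => ?_) j <;>
      simp [hbe, hp]; ring_nf; simp

/-! ### Degree 0 extension of ρ and its regularity -/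

section RadialExtension

variable {m : ℕ} {ρ : S m → ℝ}

theorem norm_sphere (θ : S m) : ‖(θ : E m)‖ = 1 := mem_sphere_zero_iff_norm.1 θ.2

theorem sphere_ne_zero (θ : S m) : (θ : E m) ≠ 0 :=
  norm_ne_zero_iff.1 (by rw [norm_sphere]; exact one_ne_zero)

theorem exists_smul_sphere {x : E m} (hx : x ≠ 0) : ∃ θ : S m, x = ‖x‖ • (θ : E m) :=
  ⟨⟨‖x‖⁻¹ • x, by simp [norm_smul, hx]⟩, by simp [smul_smul, hx]⟩

theorem radialExt_smul_sphere {c : ℝ} (hc : 0 < c) (θ : S m) :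
    radialExt ρ (c • (θ : E m)) = ρ θ := by
  have h : c • (θ : E m) ≠ 0 := smul_ne_zero hc.ne' (sphere_ne_zero θ)
  rw [radialExt, dif_neg h]
  congr 1
  ext1
  simp [norm_smul, smul_smul, abs_of_pos hc, hc.ne']

theorem radialExt_sphere (θ : S m) : radialExt ρ (θ : E m) = ρ θ := by
  simpa using radialExt_smul_sphere (ρ := ρ) one_pos θ

theorem radialExt_smul {c : ℝ} (hc : 0 < c) (x : E m) :
    radialExt ρ (c • x) = radialExt ρ x := by
  rcases eq_or_ne x 0 with rfl | hx
  · simp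
  · obtain ⟨θ, hθ⟩ := exists_smul_sphere hx
    rw [hθ, smul_smul, radialExt_smul_sphere (mul_pos hc (norm_pos_iff.2 hx)),
      radialExt_smul_sphere (norm_pos_iff.2 hx)]

theorem radialExt_pos (hpos : ∀ θ, 0 < ρ θ) {x : E m} (hx : x ≠ 0) : 0 < radialExt ρ x := by
  rw [radialExt, dif_neg hx]
  exact hpos _

/-- Compose ρ with x ↦ x/|x|, which is smooth from the punctured space, viewed as an open
submanifold, into the sphere. -/
theorem contDiffAt_radialExt (hρ : ContMDiff (𝓡 m) 𝓘(ℝ, ℝ) 2 ρ) {x : E m} (hx : x ≠ 0) :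
    ContDiffAt ℝ 2 (radialExt ρ) x := by
  let U : TopologicalSpace.Opens (E m) := ⟨{0}ᶜ, isOpen_compl_singleton⟩
  have hf : ContMDiff 𝓘(ℝ, E m) 𝓘(ℝ, E m) 2 (fun y : U => ‖(y : E m)‖⁻¹ • (y : E m)) := by
    intro y
    have hy : (y : E m) ≠ 0 := y.2
    refine (contMDiffAt_subtype_iff (f := fun y : E m => ‖y‖⁻¹ • y)).2 (ContDiffAt.contMDiffAt ?_)
    exact ((contDiffAt_norm ℝ hy).inv (norm_ne_zero_iff.2 hy)).smul contDiffAt_id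
  have hs : ∀ y : U, ‖(y : E m)‖⁻¹ • (y : E m) ∈ Metric.sphere (0 : E m) 1 := by
    intro y
    have hy : (y : E m) ≠ 0 := y.2
    simp [norm_smul, hy]
  have h := (hρ.comp (hf.codRestrict_sphere hs)) ⟨x, hx⟩
  have he : (ρ ∘ Set.codRestrict _ _ hs) = fun y : U => radialExt ρ (y : E m) := by
    funext y
    have hy : (y : E m) ≠ 0 := y.2
    simp only [radialExt, dif_neg hy]
    rfl
  rw [he] at h
  exact (contMDiffAt_subtype_iff.1 h).contDiffAt

theorem continuousAt_fderiv_fderiv {F : Type*} [NormedAddCommGroup F] [NormedSpace ℝ F]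
    {f : E m → F} {x : E m} (hf : ContDiffAt ℝ 2 f x) :
    ContinuousAt (fderiv ℝ (fderiv ℝ f)) x :=
  ((hf.fderiv_right (m := 1) (by norm_num)).fderiv_right (m := 0) (by norm_num)).continuousAt

theorem continuousAt_fderiv {F : Type*} [NormedAddCommGroup F] [NormedSpace ℝ F]
    {f : E m → F} {x : E m} (hf : ContDiffAt ℝ 2 f x) : ContinuousAt (fderiv ℝ f) x :=
  (hf.fderiv_right (m := 1) (by norm_num)).continuousAt

theorem differentiableAt_fderiv {F : Type*} [NormedAddCommGroup F] [NormedSpace ℝ F]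
    {f : E m → F} {x : E m} (hf : ContDiffAt ℝ 2 f x) : DifferentiableAt ℝ (fderiv ℝ f) x :=
  (hf.fderiv_right (m := 1) (by norm_num)).differentiableAt (by norm_num)

theorem fderiv_fderiv_symm {f : E m → ℝ} {x : E m} (hf : ContDiffAt ℝ 2 f x) (u v : E m) :
    fderiv ℝ (fderiv ℝ f) x u v = fderiv ℝ (fderiv ℝ f) x v u :=
  hf.isSymmSndFDerivAt (by simp) u v

theorem eventually_ne_zero {x : E m} (hx : x ≠ 0) : ∀ᶠ y in nhds x, y ≠ 0 :=
  isOpen_ne.mem_nhds hx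

end RadialExtension

/-! ### Homogeneity of the gauge and geometry of its level set -/

section Gauge

variable {m : ℕ} {ρ : S m → ℝ}

theorem gauge_mul_radialExt (hpos : ∀ θ, 0 < ρ θ) {x : E m} (hx : x ≠ 0) :
    gauge ρ x * radialExt ρ x = ‖x‖ :=
  div_mul_cancel₀ _ (radialExt_pos hpos hx).ne'

theorem gauge_pos (hpos : ∀ θ, 0 < ρ θ) {x : E m} (hx : x ≠ 0) : 0 < gauge ρ x :=
  div_pos (norm_pos_iff.2 hx) (radialExt_pos hpos hx)

theorem gauge_smul {c : ℝ} (hc : 0 < c) (x : E m) : gauge ρ (c • x) = c * gauge ρ x := by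
  rw [gauge, gauge, radialExt_smul hc, norm_smul, Real.norm_of_nonneg hc.le, mul_div_assoc]

theorem gauge_sphere (θ : S m) : gauge ρ (θ : E m) = 1 / ρ θ := by
  rw [gauge, norm_sphere, radialExt_sphere]

theorem contDiffAt_gauge (hρ : ContMDiff (𝓡 m) 𝓘(ℝ, ℝ) 2 ρ) (hpos : ∀ θ, 0 < ρ θ) {x : E m}
    (hx : x ≠ 0) : ContDiffAt ℝ 2 (gauge ρ) x :=
  (contDiffAt_norm ℝ hx).div (contDiffAt_radialExt hρ hx) (radialExt_pos hpos hx).ne'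

theorem fderiv_gauge_smul {c : ℝ} (hc : 0 < c) (x : E m) :
    fderiv ℝ (gauge ρ) (c • x) = fderiv ℝ (gauge ρ) x := by
  have h : (fun y => gauge ρ (c • y)) = c • gauge ρ := funext fun y => gauge_smul hc y
  have h1 := fderiv_comp_smul (𝕜 := ℝ) (f := gauge ρ) (x := x) c
  rw [h, fderiv_const_smul_field] at h1
  exact (smul_right_injective _ hc.ne' h1).symm

theorem fderiv_fderiv_gauge_smul {c : ℝ} (hc : 0 < c) (x : E m) :
    c • fderiv ℝ (fderiv ℝ (gauge ρ)) (c • x) = fderiv ℝ (fderiv ℝ (gauge ρ)) x := by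
  rw [← fderiv_comp_smul (f := fderiv ℝ (gauge ρ)) c]
  congr 1
  exact funext fun y => fderiv_gauge_smul hc y

theorem fderiv_gauge_self (hρ : ContMDiff (𝓡 m) 𝓘(ℝ, ℝ) 2 ρ) (hpos : ∀ θ, 0 < ρ θ) {x : E m}
    (hx : x ≠ 0) : fderiv ℝ (gauge ρ) x x = gauge ρ x := by
  have hc : HasDerivAt (fun t : ℝ => t • x) x 1 := by
    simpa using (hasDerivAt_id (1 : ℝ)).smul_const x
  have h1 : HasFDerivAt (gauge ρ) (fderiv ℝ (gauge ρ) x) ((1 : ℝ) • x) := by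
    rw [one_smul]
    exact ((contDiffAt_gauge hρ hpos hx).differentiableAt (by norm_num)).hasFDerivAt
  have h2 := h1.comp_hasDerivAt (1 : ℝ) hc
  have h3 : HasDerivAt (gauge ρ ∘ fun t : ℝ => t • x) (gauge ρ x) 1 := by
    have h4 : HasDerivAt (fun t : ℝ => t * gauge ρ x) (gauge ρ x) 1 := by
      simpa using (hasDerivAt_id (1 : ℝ)).mul_const (gauge ρ x)
    refine h4.congr_of_eventuallyEq ?_
    filter_upwards [lt_mem_nhds one_pos] with t ht using gauge_smul ht x
  exact h2.unique h3

/-- Dg is constant along rays, so D²g annihilates the radial direction. -/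
theorem fderiv_fderiv_gauge_self (hρ : ContMDiff (𝓡 m) 𝓘(ℝ, ℝ) 2 ρ) (hpos : ∀ θ, 0 < ρ θ)
    {x : E m} (hx : x ≠ 0) : fderiv ℝ (fderiv ℝ (gauge ρ)) x x = 0 := by
  have hc : HasDerivAt (fun t : ℝ => t • x) x 1 := by
    simpa using (hasDerivAt_id (1 : ℝ)).smul_const x
  have h1 : HasFDerivAt (fderiv ℝ (gauge ρ)) (fderiv ℝ (fderiv ℝ (gauge ρ)) x) ((1 : ℝ) • x) := by
    rw [one_smul]
    exact (differentiableAt_fderiv (contDiffAt_gauge hρ hpos hx)).hasFDerivAt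
  have h2 := h1.comp_hasDerivAt (1 : ℝ) hc
  have h3 : HasDerivAt (fderiv ℝ (gauge ρ) ∘ fun t : ℝ => t • x) 0 1 := by
    refine (hasDerivAt_const (1 : ℝ) (fderiv ℝ (gauge ρ) x)).congr_of_eventuallyEq ?_
    filter_upwards [lt_mem_nhds one_pos] with t ht using fderiv_gauge_smul ht x
  exact h2.unique h3

theorem radialEmb_eq_smul (x : E m) : radialEmb ρ x = (radialExt ρ x * ‖x‖⁻¹) • x := by
  rw [radialEmb, smul_smul]

theorem contDiffAt_radialEmb (hρ : ContMDiff (𝓡 m) 𝓘(ℝ, ℝ) 2 ρ) {x : E m} (hx : x ≠ 0) :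
    ContDiffAt ℝ 2 (radialEmb ρ) x :=
  (contDiffAt_radialExt hρ hx).smul
    (((contDiffAt_norm ℝ hx).inv (norm_ne_zero_iff.2 hx)).smul contDiffAt_id)

theorem gauge_radialEmb (hpos : ∀ θ, 0 < ρ θ) {x : E m} (hx : x ≠ 0) :
    gauge ρ (radialEmb ρ x) = 1 := by
  have h1 := radialExt_pos hpos hx
  have h2 := norm_pos_iff.2 hx
  rw [radialEmb_eq_smul, gauge_smul (by positivity), gauge]
  field_simp

/-- Differentiate g = 1 along the radial graph. The derivative of g can be taken at `x` itself,
since the embedded point is a positive multiple of `x` and Dg has degree 0. -/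
theorem fderiv_gauge_fderiv_radialEmb (hρ : ContMDiff (𝓡 m) 𝓘(ℝ, ℝ) 2 ρ) (hpos : ∀ θ, 0 < ρ θ)
    {x : E m} (hx : x ≠ 0) (u : E m) :
    fderiv ℝ (gauge ρ) x (fderiv ℝ (radialEmb ρ) x u) = 0 := by
  have h1 := radialExt_pos hpos hx
  have h2 := norm_pos_iff.2 hx
  have h3 : 0 < radialExt ρ x * ‖x‖⁻¹ := by positivity
  have hX : HasFDerivAt (radialEmb ρ) (fderiv ℝ (radialEmb ρ) x) x :=
    ((contDiffAt_radialEmb hρ hx).differentiableAt (by norm_num)).hasFDerivAt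
  have hg : HasFDerivAt (gauge ρ) (fderiv ℝ (gauge ρ) x) (radialEmb ρ x) := by
    rw [← fderiv_gauge_smul h3 x, ← radialEmb_eq_smul]
    refine ((contDiffAt_gauge hρ hpos ?_).differentiableAt (by norm_num)).hasFDerivAt
    rw [radialEmb_eq_smul]
    exact smul_ne_zero h3.ne' hx
  have h4 := hg.comp x hX
  have h5 : HasFDerivAt (gauge ρ ∘ radialEmb ρ) (0 : E m →L[ℝ] ℝ) x := by
    refine (hasFDerivAt_const (1 : ℝ) x).congr_of_eventuallyEq ?_
    filter_upwards [eventually_ne_zero hx] with y hy using gauge_radialEmb hpos hy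
  simpa using congrArg (fun T : E m →L[ℝ] ℝ => T u) (h4.unique h5)

/-- Differentiating the tangency relation once more links D²g to the second derivatives of the
embedding, hence to the second fundamental form. -/
theorem fderiv_fderiv_gauge_fderiv_radialEmb (hρ : ContMDiff (𝓡 m) 𝓘(ℝ, ℝ) 2 ρ)
    (hpos : ∀ θ, 0 < ρ θ) {x : E m} (hx : x ≠ 0) (u v : E m) :
    fderiv ℝ (fderiv ℝ (gauge ρ)) x v (fderiv ℝ (radialEmb ρ) x u) =
      -fderiv ℝ (gauge ρ) x (fderiv ℝ (fderiv ℝ (radialEmb ρ)) x v u) := by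
  have h1 := (differentiableAt_fderiv (contDiffAt_gauge hρ hpos hx)).hasFDerivAt
  have h2 := (differentiableAt_fderiv (contDiffAt_radialEmb hρ hx)).hasFDerivAt.clm_apply
    (hasFDerivAt_const u x)
  have h3 := h1.clm_apply h2
  have h4 : HasFDerivAt (fun y => fderiv ℝ (gauge ρ) y (fderiv ℝ (radialEmb ρ) y u))
      (0 : E m →L[ℝ] ℝ) x := by
    refine (hasFDerivAt_const (0 : ℝ) x).congr_of_eventuallyEq ?_
    filter_upwards [eventually_ne_zero hx] with y hy using
      fderiv_gauge_fderiv_radialEmb hρ hpos hy u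
  have h5 := congrArg (fun T : E m →L[ℝ] ℝ => T v) (h3.unique h4)
  simp at h5
  linarith

theorem fderiv_radialEmb_sphere (hρ : ContMDiff (𝓡 m) 𝓘(ℝ, ℝ) 2 ρ) (θ : S m) (u : E m) :
    ∃ s : ℝ, fderiv ℝ (radialEmb ρ) (θ : E m) u = ρ θ • u + s • (θ : E m) := by
  have hx := sphere_ne_zero θ
  have h1 : DifferentiableAt ℝ (fun y : E m => radialExt ρ y * ‖y‖⁻¹) θ :=
    (((contDiffAt_radialExt hρ hx).mul
      ((contDiffAt_norm ℝ hx).inv (norm_ne_zero_iff.2 hx)))).differentiableAt (by norm_num)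
  have h2 := h1.hasFDerivAt.smul (hasFDerivAt_id (θ : E m))
  refine ⟨fderiv ℝ (fun y : E m => radialExt ρ y * ‖y‖⁻¹) θ u, ?_⟩
  rw [show radialEmb ρ = (fun y => radialExt ρ y * ‖y‖⁻¹) • id from
    funext fun y => radialEmb_eq_smul y, h2.fderiv]
  simp [radialExt_sphere]

/-- An orthonormal frame adapted to the level set of the gauge, in which the Hessian of the gauge
is expressed by the principal curvatures of the radial graph. -/
theorem IsPrincipalCurvatures.exists_frame (hρ : ContMDiff (𝓡 m) 𝓘(ℝ, ℝ) 2 ρ)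
    (hpos : ∀ θ, 0 < ρ θ) {θ : S m} {κ : Fin m → ℝ} (h : IsPrincipalCurvatures ρ θ κ) :
    ∃ (ν : E m) (w : Fin m → E m), Orthonormal ℝ (Fin.cons ν w : Fin (m + 1) → E m) ∧
      (∀ i, fderiv ℝ (gauge ρ) θ (w i) = 0) ∧
      fderiv ℝ (gauge ρ) θ ν = ‖fderiv ℝ (gauge ρ) (θ : E m)‖ ∧
      1 / ρ θ ≤ ‖fderiv ℝ (gauge ρ) (θ : E m)‖ ∧
      ∀ i j, fderiv ℝ (fderiv ℝ (gauge ρ)) θ (w i) (w j) =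
        if i = j then ρ θ * ‖fderiv ℝ (gauge ρ) (θ : E m)‖ * κ i else 0 := by
  obtain ⟨ν, u, ⟨hν, hνu, hθν⟩, hu, h1, h2⟩ := h
  have hx := sphere_ne_zero θ
  set p := fderiv ℝ (gauge ρ) (θ : E m)
  set w : Fin m → E m := fun i => fderiv ℝ (radialEmb ρ) (θ : E m) (u i)
  have hb : Orthonormal ℝ (Fin.cons ν w : Fin (m + 1) → E m) := by
    rw [orthonormal_iff_ite]
    intro i j
    refine Fin.cases ?_ (fun i => ?_) i <;> refine Fin.cases ?_ (fun j => ?_) j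
    · simp [hν]
    · have := hνu (u j) (hu j)
      rw [real_inner_comm] at this
      simpa [(Fin.succ_ne_zero j).symm] using this
    · simpa using hνu (u i) (hu i)
    · simpa [firstForm] using h1 i j
  have hpw : ∀ i, p (w i) = 0 := fun i => fderiv_gauge_fderiv_radialEmb hρ hpos hx (u i)
  -- Dg vanishes on tangent vectors, so it is a multiple of the inner product with ν.
  have hp : ∀ x, p x = inner ℝ ν x * p ν := by
    intro x
    obtain ⟨b, hbe⟩ : ∃ b : OrthonormalBasis (Fin (m + 1)) ℝ (E m), ⇑b = Fin.cons ν w := by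
      refine ⟨OrthonormalBasis.mk hb ?_, OrthonormalBasis.coe_mk hb _⟩
      have h := (basisOfOrthonormalOfCardEqFinrank hb (by simp)).span_eq
      rw [coe_basisOfOrthonormalOfCardEqFinrank] at h
      exact h.ge
    conv_lhs => rw [← b.sum_repr' x]
    rw [map_sum, Fin.sum_univ_succ]
    simp [hbe, hpw]
  -- Euler's identity at θ. It fixes the sign of `p ν` and, as ⟨ν, θ⟩ ≤ 1, gives the lower bound on
  -- its size.
  have hpθ : inner ℝ ν (θ : E m) * p ν = 1 / ρ θ := by
    rw [← hp, ← gauge_sphere θ]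
    exact fderiv_gauge_self hρ hpos hx
  rw [real_inner_comm] at hθν
  have hc : 0 < p ν := by
    have : 0 < inner ℝ ν (θ : E m) * p ν := by rw [hpθ]; exact one_div_pos.2 (hpos θ)
    exact (pos_iff_pos_of_mul_pos this).1 hθν
  have hn : p ν = ‖p‖ := by
    refine le_antisymm ?_ (p.opNorm_le_bound hc.le fun x => ?_)
    · have := p.le_opNorm ν
      rw [hν, mul_one] at this
      exact (le_abs_self _).trans this
    · rw [hp, norm_mul, Real.norm_of_nonneg hc.le, mul_comm]
      refine mul_le_mul_of_nonneg_left ?_ hc.le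
      simpa [hν] using norm_inner_le_norm (𝕜 := ℝ) ν x
  refine ⟨ν, w, hb, hpw, hn, ?_, fun i j => ?_⟩
  · rw [← hn, ← hpθ]
    have : inner ℝ ν (θ : E m) ≤ 1 := by
      simpa [hν, norm_sphere] using real_inner_le_norm ν (θ : E m)
    nlinarith
  · obtain ⟨s, hs⟩ := fderiv_radialEmb_sphere hρ θ (u i)
    -- w i is ρ u i plus a radial vector, which D²g kills.
    have e1 : fderiv ℝ (fderiv ℝ (gauge ρ)) (θ : E m) (w i) =
        ρ θ • fderiv ℝ (fderiv ℝ (gauge ρ)) (θ : E m) (u i) := by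
      simp only [w, hs, map_add, map_smul, fderiv_fderiv_gauge_self hρ hpos hx, smul_zero,
        add_zero]
    have e2 := h2 i j
    rw [secondForm] at e2
    rw [e1, smul_apply, fderiv_fderiv_gauge_fderiv_radialEmb hρ hpos hx, hp, real_inner_comm,
      ← hn, smul_eq_mul]
    split_ifs at e2 ⊢ with hij
    · linear_combination (ρ θ * p ν) * e2
    · linear_combination (ρ θ * p ν) * e2

end Gauge

/-! ### The Hessian of the power and the slope of σ_k -/

section Power

variable {m : ℕ} {ρ : S m → ℝ}

theorem hessian_phi (hρ : ContMDiff (𝓡 m) 𝓘(ℝ, ℝ) 2 ρ) (hpos : ∀ θ, 0 < ρ θ) (N : ℝ) {x : E m}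
    (hx : x ≠ 0) :
    fderiv ℝ (fderiv ℝ (phi ρ N)) x =
      (N * gauge ρ x ^ (N - 1)) • fderiv ℝ (fderiv ℝ (gauge ρ)) x +
        (N * ((N - 1) * gauge ρ x ^ (N - 1 - 1))) •
          (fderiv ℝ (gauge ρ) x).smulRight (fderiv ℝ (gauge ρ) x) := by
  have hd : ∀ y : E m, y ≠ 0 → ∀ p : ℝ, HasFDerivAt (fun z => gauge ρ z ^ p)
      ((p * gauge ρ y ^ (p - 1)) • fderiv ℝ (gauge ρ) y) y := fun y hy p =>
    ((contDiffAt_gauge hρ hpos hy).differentiableAt (by norm_num)).hasFDerivAt.rpow_const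
      (Or.inl (gauge_pos hpos hy).ne')
  have h1 : fderiv ℝ (phi ρ N) =ᶠ[nhds x]
      fun y => (N * gauge ρ y ^ (N - 1)) • fderiv ℝ (gauge ρ) y := by
    filter_upwards [eventually_ne_zero hx] with y hy using (hd y hy N).fderiv
  have h2 := ((hd x hx (N - 1)).const_mul N).smul
    (differentiableAt_fderiv (contDiffAt_gauge hρ hpos hx)).hasFDerivAt
  rw [h1.fderiv_eq]
  refine h2.fderiv.trans ?_
  ext u v
  simp
  ring

theorem contDiffOn_phi (hρ : ContMDiff (𝓡 m) 𝓘(ℝ, ℝ) 2 ρ) (hpos : ∀ θ, 0 < ρ θ) (N : ℝ) :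
    ContDiffOn ℝ 2 (phi ρ N) {0}ᶜ := fun _ hx =>
  ((contDiffAt_gauge hρ hpos hx).rpow_const_of_ne (gauge_pos hpos hx).ne').contDiffWithinAt

/-- The increment of `σ_k` of the Hessian of the gauge under the rank one term `Dg ⊗ Dg`. -/
noncomputable def sigmaSlope (k : ℕ) (ρ : S m → ℝ) (θ : S m) : ℝ :=
  sigmaMat k (bilinMat (fderiv ℝ (fderiv ℝ (gauge ρ)) (θ : E m) +
    (fderiv ℝ (gauge ρ) (θ : E m)).smulRight (fderiv ℝ (gauge ρ) (θ : E m)))) -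
  sigmaMat k (bilinMat (fderiv ℝ (fderiv ℝ (gauge ρ)) (θ : E m)))

theorem sigmaVec_smul {n k : ℕ} (c : ℝ) (l : Fin n → ℝ) :
    sigmaVec k (fun i => c * l i) = c ^ k * sigmaVec k l := by
  rw [sigmaVec, sigmaVec, Finset.esymm_map_val, Finset.esymm_map_val, Finset.mul_sum]
  refine Finset.sum_congr rfl fun s hs => ?_
  rw [Finset.prod_mul_distrib, Finset.prod_const, (Finset.mem_powersetCard.1 hs).2]

theorem fderiv_fderiv_gauge_symm (hρ : ContMDiff (𝓡 m) 𝓘(ℝ, ℝ) 2 ρ) (hpos : ∀ θ, 0 < ρ θ)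
    (θ : S m) (u v : E m) : fderiv ℝ (fderiv ℝ (gauge ρ)) (θ : E m) u v =
      fderiv ℝ (fderiv ℝ (gauge ρ)) (θ : E m) v u :=
  fderiv_fderiv_symm (contDiffAt_gauge hρ hpos (sphere_ne_zero θ)) u v

theorem IsPrincipalCurvatures.sigmaMat_add {k : ℕ} (hk : 1 ≤ k) (hkm : k ≤ m + 1)
    (hρ : ContMDiff (𝓡 m) 𝓘(ℝ, ℝ) 2 ρ) (hpos : ∀ θ, 0 < ρ θ) {θ : S m} {κ : Fin m → ℝ}
    (h : IsPrincipalCurvatures ρ θ κ) (t : ℝ) :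
    sigmaMat k (bilinMat (fderiv ℝ (fderiv ℝ (gauge ρ)) (θ : E m) +
      t • (fderiv ℝ (gauge ρ) (θ : E m)).smulRight (fderiv ℝ (gauge ρ) (θ : E m)))) =
    sigmaMat k (bilinMat (fderiv ℝ (fderiv ℝ (gauge ρ)) (θ : E m))) +
      t * (‖fderiv ℝ (gauge ρ) (θ : E m)‖ ^ 2 *
        ((ρ θ * ‖fderiv ℝ (gauge ρ) (θ : E m)‖) ^ (k - 1) * sigmaVec (k - 1) κ)) := by
  obtain ⟨ν, w, hb, hp, hn, -, hl⟩ := h.exists_frame hρ hpos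
  rw [sigmaMat_add_rankOne hk hkm (fderiv_fderiv_gauge_symm hρ hpos θ) hb hp hl, sigmaVec_smul, hn]

theorem IsPrincipalCurvatures.sigmaSlope_eq {k : ℕ} (hk : 1 ≤ k) (hkm : k ≤ m + 1)
    (hρ : ContMDiff (𝓡 m) 𝓘(ℝ, ℝ) 2 ρ) (hpos : ∀ θ, 0 < ρ θ) {θ : S m} {κ : Fin m → ℝ}
    (h : IsPrincipalCurvatures ρ θ κ) :
    sigmaSlope k ρ θ = ‖fderiv ℝ (gauge ρ) (θ : E m)‖ ^ 2 *
      ((ρ θ * ‖fderiv ℝ (gauge ρ) (θ : E m)‖) ^ (k - 1)) * sigmaVec (k - 1) κ := by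
  have h1 := h.sigmaMat_add hk hkm hρ hpos 1
  rw [one_smul] at h1
  rw [sigmaSlope, h1]
  ring

theorem sigmaMat_hessian_phi {k : ℕ} (hk : 1 ≤ k) (hkm : k ≤ m + 1)
    (hρ : ContMDiff (𝓡 m) 𝓘(ℝ, ℝ) 2 ρ) (hpos : ∀ θ, 0 < ρ θ) {θ : S m} {κ : Fin m → ℝ}
    (h : IsPrincipalCurvatures ρ θ κ) {N r : ℝ} (hN : 0 < N) (hr : 0 < r) :
    sigmaMat k (hessian (phi ρ N) (r • (θ : E m))) =
      N ^ k * gauge ρ (r • (θ : E m)) ^ ((k : ℝ) * N - k) / r ^ k *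
        (sigmaMat k (bilinMat (fderiv ℝ (fderiv ℝ (gauge ρ)) (θ : E m))) +
          (N - 1) * ρ θ * sigmaSlope k ρ θ) := by
  have hx : r • (θ : E m) ≠ 0 := smul_ne_zero hr.ne' (sphere_ne_zero θ)
  set A := fderiv ℝ (fderiv ℝ (gauge ρ)) (θ : E m)
  set p := fderiv ℝ (gauge ρ) (θ : E m)
  have hg := gauge_pos hpos hx
  have hg' : gauge ρ (r • (θ : E m)) * ρ θ = r := by
    rw [gauge_smul hr, gauge_sphere]
    field_simp [(hpos θ).ne']
  set g := gauge ρ (r • (θ : E m))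
  have hA : fderiv ℝ (fderiv ℝ (gauge ρ)) (r • (θ : E m)) = r⁻¹ • A := by
    rw [eq_inv_smul_iff₀ hr.ne']
    exact fderiv_fderiv_gauge_smul hr (θ : E m)
  have hp : fderiv ℝ (gauge ρ) (r • (θ : E m)) = p := fderiv_gauge_smul hr (θ : E m)
  have e : hessian (phi ρ N) (r • (θ : E m)) = (N * g ^ (N - 1) / r) •
      bilinMat (A + ((N - 1) * ρ θ) • p.smulRight p) := by
    change bilinMat (fderiv ℝ (fderiv ℝ (phi ρ N)) (r • (θ : E m))) = _
    rw [hessian_phi hρ hpos N hx, hA, hp, Real.rpow_sub_one hg.ne' (N - 1)]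
    ext i j
    simp only [bilinMat, Matrix.of_apply, Matrix.smul_apply, add_apply, smul_apply, smul_eq_mul]
    -- Uses 1/g = ρ/r to pull out the common factor.
    have : g ^ (N - 1) / g = g ^ (N - 1) / r * ρ θ := by
      rw [div_eq_iff hg.ne', mul_assoc, mul_comm (ρ θ), hg', div_mul_cancel₀ _ hr.ne']
    rw [this]
    ring
  have hs : ∀ u v, (A + ((N - 1) * ρ θ) • p.smulRight p) u v =
      (A + ((N - 1) * ρ θ) • p.smulRight p) v u := by
    intro u v
    simp [A, fderiv_fderiv_gauge_symm hρ hpos θ u v, mul_comm (p u)]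
  have hgN : 0 < g ^ (N - 1) := Real.rpow_pos_of_pos hg _
  rw [e, sigmaMat_smul (isHermitian_bilinMat hs) hkm (by positivity),
    h.sigmaMat_add hk hkm hρ hpos, h.sigmaSlope_eq hk hkm hρ hpos, div_pow, mul_pow,
    ← Real.rpow_mul_natCast hg.le, show (N - 1) * (k : ℝ) = k * N - k by ring]
  ring

/-- Principal curvatures chosen point by point carry no continuity; this expression avoids them and
is polynomial in Dg and D²g. -/
theorem continuous_sigmaSlope {k : ℕ} (hkm : k ≤ m + 1) (hρ : ContMDiff (𝓡 m) 𝓘(ℝ, ℝ) 2 ρ)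
    (hpos : ∀ θ, 0 < ρ θ) : Continuous (sigmaSlope k ρ) := by
  have hp : Continuous fun θ : S m => fderiv ℝ (gauge ρ) (θ : E m) :=
    continuous_iff_continuousAt.2 fun θ =>
      (continuousAt_fderiv (contDiffAt_gauge hρ hpos (sphere_ne_zero θ))).comp
        continuous_subtype_val.continuousAt
  have hA : Continuous fun θ : S m => fderiv ℝ (fderiv ℝ (gauge ρ)) (θ : E m) :=
    continuous_iff_continuousAt.2 fun θ =>
      (continuousAt_fderiv_fderiv (contDiffAt_gauge hρ hpos (sphere_ne_zero θ))).comp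
        continuous_subtype_val.continuousAt
  have hs := fderiv_fderiv_gauge_symm hρ hpos
  have e : sigmaSlope k ρ = fun θ : S m =>
      (-1) ^ k * (bilinMat (fderiv ℝ (fderiv ℝ (gauge ρ)) (θ : E m) +
        (fderiv ℝ (gauge ρ) (θ : E m)).smulRight
          (fderiv ℝ (gauge ρ) (θ : E m)))).charpoly.coeff (m + 1 - k) -
      (-1) ^ k * (bilinMat (fderiv ℝ (fderiv ℝ (gauge ρ)) (θ : E m))).charpoly.coeff
        (m + 1 - k) := by
    funext θ
    rw [sigmaSlope, sigmaMat_eq_coeff (isHermitian_bilinMat (hs θ)) hkm,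
      sigmaMat_eq_coeff (isHermitian_bilinMat fun u v => ?_) hkm]
    simp [hs θ u v, mul_comm]
  have hc := continuous_charpoly_coeff (m + 1) (m + 1 - k)
  rw [e]
  refine ((hc.comp ?_).const_mul _).sub ((hc.comp ?_).const_mul _) <;>
    refine continuous_matrix fun i j => ?_ <;>
    simp only [bilinMat, Matrix.of_apply, add_apply, ContinuousLinearMap.smulRight_apply,
      smul_apply] <;>
    fun_prop

end Power

/-! ### Norm estimates in a general normed space -/

section NormedSpaceLemmas

variable {V : Type*} [NormedAddCommGroup V]

theorem continuousAt_norm_fderiv_fderiv [NormedSpace ℝ V] {f : V → ℝ} {x : V}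
    (hf : ContDiffAt ℝ 2 f x) : ContinuousAt (fun y => ‖fderiv ℝ (fderiv ℝ f) y‖) x :=
  ((hf.fderiv_right (m := 1) (by norm_num)).fderiv_right (m := 0) (by norm_num)).continuousAt.norm

theorem norm_add_smulRight_le [NormedSpace ℝ V] {A : V →L[ℝ] V →L[ℝ] ℝ} {p : V →L[ℝ] ℝ}
    {a P : ℝ} (hA : ‖A‖ ≤ a) (hp : ‖p‖ ≤ P) : ‖A + p.smulRight p‖ ≤ a + P ^ 2 := by
  have h1 : ‖p.smulRight p‖ = ‖p‖ * ‖p‖ := ContinuousLinearMap.norm_smulRight_apply p p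
  have h2 := ContinuousLinearMap.opNorm_add_le A (p.smulRight p)
  nlinarith [norm_nonneg p]

/-- Meant for A = D²g, D the Hessian of the norm, B that of the extension of ρ, and F, G the two
cross terms of the product rule. -/
theorem norm_le_of_smul_eq_sub [NormedSpace ℝ V] {A B D F G : V} {r a b M Q : ℝ} (ha : 0 < a)
    (har : a ≤ r) (h : r • A = D - ((1 / r) • B + F + G)) (hB : ‖B‖ ≤ b) (hD : ‖D‖ ≤ M)
    (hF : ‖F‖ ≤ Q) (hG : ‖G‖ ≤ Q) : ‖A‖ ≤ (M + (b / a + 2 * Q)) / a := by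
  have hr : 0 < r := ha.trans_le har
  have h1 := congrArg norm h
  rw [norm_smul, Real.norm_of_nonneg hr.le] at h1
  have h4 : ‖(1 / r) • B‖ ≤ b / a := by
    rw [norm_smul, Real.norm_of_nonneg (one_div_pos.2 hr).le, div_eq_mul_one_div b, mul_comm b]
    exact mul_le_mul (one_div_le_one_div_of_le ha har) hB (norm_nonneg _) (by positivity)
  have h6 := norm_sub_le D ((1 / r) • B + F + G)
  have h7 : ‖(1 / r) • B + F + G‖ ≤ _ := norm_add₃_le
  rw [le_div_iff₀ ha, mul_comm]
  calc a * ‖A‖ ≤ r * ‖A‖ := by gcongr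
    _ ≤ M + (b / a + 2 * Q) := by linarith

end NormedSpaceLemmas

/-! ### Bounds depending only on min ρ and the C² norm -/

section Bounds

variable {m : ℕ} {ρ : S m → ℝ}

theorem fderiv_mul_radialExt (hρ : ContMDiff (𝓡 m) 𝓘(ℝ, ℝ) 2 ρ) (hpos : ∀ θ, 0 < ρ θ) {x : E m}
    (hx : x ≠ 0) : gauge ρ x • fderiv ℝ (radialExt ρ) x + radialExt ρ x • fderiv ℝ (gauge ρ) x =
      fderiv ℝ (fun y : E m => ‖y‖) x := by
  have h1 := ((contDiffAt_gauge hρ hpos hx).differentiableAt (by norm_num)).hasFDerivAt.mul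
    ((contDiffAt_radialExt hρ hx).differentiableAt (by norm_num)).hasFDerivAt
  rw [← h1.fderiv]
  refine Filter.EventuallyEq.fderiv_eq ?_
  filter_upwards [eventually_ne_zero hx] with y hy using gauge_mul_radialExt hpos hy

/-- Differentiating the product g · ρ(x/|x|) = |x| twice avoids the quotient rule and isolates D²g.
-/
theorem fderiv_fderiv_mul_radialExt (hρ : ContMDiff (𝓡 m) 𝓘(ℝ, ℝ) 2 ρ) (hpos : ∀ θ, 0 < ρ θ)
    {x : E m} (hx : x ≠ 0) :
    radialExt ρ x • fderiv ℝ (fderiv ℝ (gauge ρ)) x =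
      fderiv ℝ (fderiv ℝ (fun y : E m => ‖y‖)) x -
        (gauge ρ x • fderiv ℝ (fderiv ℝ (radialExt ρ)) x +
          (fderiv ℝ (gauge ρ) x).smulRight (fderiv ℝ (radialExt ρ) x) +
          (fderiv ℝ (radialExt ρ) x).smulRight (fderiv ℝ (gauge ρ) x)) := by
  have hg := contDiffAt_gauge hρ hpos hx
  have hR := contDiffAt_radialExt hρ hx
  have h1 := ((hg.differentiableAt (by norm_num)).hasFDerivAt.smul
    (differentiableAt_fderiv hR).hasFDerivAt).add
    ((hR.differentiableAt (by norm_num)).hasFDerivAt.smul (differentiableAt_fderiv hg).hasFDerivAt)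
  have h2 : fderiv ℝ (fun y : E m => ‖y‖) =ᶠ[nhds x]
      gauge ρ • fderiv ℝ (radialExt ρ) + radialExt ρ • fderiv ℝ (gauge ρ) := by
    filter_upwards [eventually_ne_zero hx] with y hy using (fderiv_mul_radialExt hρ hpos hy).symm
  rw [h2.fderiv_eq, h1.fderiv]
  abel

theorem norm_fderiv_norm_le (x : E m) : ‖fderiv ℝ (fun y : E m => ‖y‖) x‖ ≤ 1 := by
  simpa using norm_fderiv_le_of_lipschitz ℝ (x₀ := x) (lipschitzWith_one_norm (E := E m))

theorem norm_fderiv_gauge_le (hρ : ContMDiff (𝓡 m) 𝓘(ℝ, ℝ) 2 ρ) (hpos : ∀ θ, 0 < ρ θ) {a b : ℝ}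
    (ha : 0 < a) (θ : S m) (haθ : a ≤ ρ θ) (hb : ‖fderiv ℝ (radialExt ρ) (θ : E m)‖ ≤ b) :
    ‖fderiv ℝ (gauge ρ) (θ : E m)‖ ≤ (1 + b / a) / a := by
  have h := fderiv_mul_radialExt hρ hpos (sphere_ne_zero θ)
  rw [gauge_sphere, radialExt_sphere, ← eq_sub_iff_add_eq'] at h
  have h1 := congrArg norm h
  rw [norm_smul, Real.norm_of_nonneg (hpos θ).le] at h1
  have h2 := norm_sub_le (fderiv ℝ (fun y : E m => ‖y‖) θ)
    ((1 / ρ θ) • fderiv ℝ (radialExt ρ) (θ : E m))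
  rw [norm_smul, Real.norm_of_nonneg (one_div_pos.2 (hpos θ)).le] at h2
  have h3 := norm_fderiv_norm_le (θ : E m)
  have hb0 : 0 ≤ b := (norm_nonneg _).trans hb
  have h4 : 1 / ρ θ * ‖fderiv ℝ (radialExt ρ) (θ : E m)‖ ≤ 1 / a * b :=
    mul_le_mul (one_div_le_one_div_of_le ha haθ) hb (norm_nonneg _) (by positivity)
  rw [le_div_iff₀ ha, mul_comm]
  calc a * ‖fderiv ℝ (gauge ρ) (θ : E m)‖ ≤ ρ θ * ‖fderiv ℝ (gauge ρ) (θ : E m)‖ := by gcongr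
    _ ≤ 1 + b / a := by rw [div_eq_mul_one_div b, mul_comm b]; linarith

theorem norm_fderiv_fderiv_gauge_le (hρ : ContMDiff (𝓡 m) 𝓘(ℝ, ℝ) 2 ρ) (hpos : ∀ θ, 0 < ρ θ)
    {a b M : ℝ} (ha : 0 < a) (θ : S m) (haθ : a ≤ ρ θ)
    (hb : ‖fderiv ℝ (radialExt ρ) (θ : E m)‖ ≤ b)
    (hb' : ‖fderiv ℝ (fderiv ℝ (radialExt ρ)) (θ : E m)‖ ≤ b)
    (hM : ‖fderiv ℝ (fderiv ℝ (fun y : E m => ‖y‖)) (θ : E m)‖ ≤ M) :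
    ‖fderiv ℝ (fderiv ℝ (gauge ρ)) (θ : E m)‖ ≤
      (M + (b / a + 2 * ((1 + b / a) / a * b))) / a := by
  have hp := norm_fderiv_gauge_le hρ hpos ha θ haθ hb
  have h := fderiv_fderiv_mul_radialExt hρ hpos (sphere_ne_zero θ)
  rw [gauge_sphere, radialExt_sphere] at h
  have hpq : ‖fderiv ℝ (gauge ρ) (θ : E m)‖ * ‖fderiv ℝ (radialExt ρ) (θ : E m)‖ ≤
      (1 + b / a) / a * b := mul_le_mul hp hb (norm_nonneg _) ((norm_nonneg _).trans hp)
  refine norm_le_of_smul_eq_sub (V := E m →L[ℝ] E m →L[ℝ] ℝ) ha haθ h hb' hM ?_ ?_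
  · exact (ContinuousLinearMap.norm_smulRight_apply _ _).trans_le hpq
  · exact (ContinuousLinearMap.norm_smulRight_apply _ _).trans_le ((mul_comm _ _).trans_le hpq)

theorem exists_norm_hessian_bound (m : ℕ) : ∃ M : ℝ, ∀ θ : S m,
    ‖fderiv ℝ (fderiv ℝ (fun y : E m => ‖y‖)) (θ : E m)‖ ≤ M := by
  have hc : Continuous fun θ : S m => ‖fderiv ℝ (fderiv ℝ (fun y : E m => ‖y‖)) (θ : E m)‖ :=
    continuous_iff_continuousAt.2 fun θ =>
      (continuousAt_norm_fderiv_fderiv (contDiffAt_norm ℝ (sphere_ne_zero θ))).comp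
        continuous_subtype_val.continuousAt
  obtain ⟨M, hM⟩ := (isCompact_range hc).bddAbove
  exact ⟨M, fun θ => hM ⟨θ, rfl⟩⟩

theorem le_c2Norm (hρ : ContMDiff (𝓡 m) 𝓘(ℝ, ℝ) 2 ρ) (θ : S m) :
    |ρ θ| + ‖fderiv ℝ (radialExt ρ) (θ : E m)‖ +
      ‖fderiv ℝ (fderiv ℝ (radialExt ρ)) (θ : E m)‖ ≤ c2Norm ρ := by
  have hp : Continuous fun θ : S m => fderiv ℝ (radialExt ρ) (θ : E m) :=
    continuous_iff_continuousAt.2 fun θ =>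
      (continuousAt_fderiv (contDiffAt_radialExt hρ (sphere_ne_zero θ))).comp
        continuous_subtype_val.continuousAt
  have hA : Continuous fun θ : S m => ‖fderiv ℝ (fderiv ℝ (radialExt ρ)) (θ : E m)‖ :=
    continuous_iff_continuousAt.2 fun θ =>
      (continuousAt_norm_fderiv_fderiv (contDiffAt_radialExt hρ (sphere_ne_zero θ))).comp
        continuous_subtype_val.continuousAt
  have hc := (hρ.continuous.abs.add hp.norm).add hA
  exact le_ciSup (isCompact_range hc).bddAbove θ

theorem exists_iInf_eq (hc : Continuous ρ) : ∃ θ, ⨅ θ, ρ θ = ρ θ ∧ ∀ θ', ρ θ ≤ ρ θ' := by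
  have : Nonempty (S m) := (NormedSpace.sphere_nonempty.2 zero_le_one).to_subtype
  obtain ⟨θ, -, hθ⟩ := isCompact_univ.exists_isMinOn Set.univ_nonempty hc.continuousOn
  have h : ∀ θ', ρ θ ≤ ρ θ' := fun θ' => hθ (Set.mem_univ θ')
  exact ⟨θ, le_antisymm (ciInf_le ⟨ρ θ, by rintro _ ⟨θ', rfl⟩; exact h θ'⟩ θ) (le_ciInf h), h⟩

/-- Bounds for `σ_k` of the Hessian of the gauge and its rank one increment on the sphere, in terms
of the minimum and the `C²` norm of the radial function only. -/
theorem exists_sigma_bounds {k : ℕ} (hkm : k ≤ m + 1) :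
    ∃ K : ℝ → ℝ → ℝ, (∀ a b, 0 ≤ K a b) ∧ ∀ ρ : S m → ℝ, ContMDiff (𝓡 m) 𝓘(ℝ, ℝ) 2 ρ →
      (∀ θ, 0 < ρ θ) → ∀ θ : S m,
      |sigmaMat k (bilinMat (fderiv ℝ (fderiv ℝ (gauge ρ)) (θ : E m)))| ≤
        K (⨅ θ, ρ θ) (c2Norm ρ) ∧
      |sigmaSlope k ρ θ| ≤ 2 * K (⨅ θ, ρ θ) (c2Norm ρ) := by
  obtain ⟨M, hM⟩ := exists_norm_hessian_bound m
  choose K hK0 hK using exists_charpoly_coeff_bound (m + 1) (m + 1 - k)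
  -- The first summand bounds ‖D²g‖, the second ‖Dg‖², so one constant serves both with and without
  -- the rank one term.
  refine ⟨fun a b => K ((M + (b / a + 2 * ((1 + b / a) / a * b))) / a + ((1 + b / a) / a) ^ 2),
    fun a b => hK0 _, fun ρ hρ hpos θ => ?_⟩
  obtain ⟨θ₀, ha, haθ⟩ := exists_iInf_eq hρ.continuous
  have ha0 : 0 < ⨅ θ, ρ θ := ha ▸ hpos θ₀
  have haθ' : ⨅ θ, ρ θ ≤ ρ θ := ha ▸ haθ θ
  set a := ⨅ θ, ρ θ
  have hb := le_c2Norm hρ θ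
  set b := c2Norm ρ
  have hb1 : ‖fderiv ℝ (radialExt ρ) (θ : E m)‖ ≤ b := by
    linarith [abs_nonneg (ρ θ), norm_nonneg (fderiv ℝ (fderiv ℝ (radialExt ρ)) (θ : E m))]
  have hb2 : ‖fderiv ℝ (fderiv ℝ (radialExt ρ)) (θ : E m)‖ ≤ b := by
    linarith [abs_nonneg (ρ θ), norm_nonneg (fderiv ℝ (radialExt ρ) (θ : E m))]
  have hp := norm_fderiv_gauge_le hρ hpos ha0 θ haθ' hb1
  have hA := norm_fderiv_fderiv_gauge_le hρ hpos ha0 θ haθ' hb1 hb2 (hM θ)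
  have hs := fderiv_fderiv_gauge_symm hρ hpos θ
  have hsig : ∀ T : E m →L[ℝ] E m →L[ℝ] ℝ, (∀ u v, T u v = T v u) →
      ‖T‖ ≤ (M + (b / a + 2 * ((1 + b / a) / a * b))) / a + ((1 + b / a) / a) ^ 2 →
      |sigmaMat k (bilinMat T)| ≤
        K ((M + (b / a + 2 * ((1 + b / a) / a * b))) / a + ((1 + b / a) / a) ^ 2) := by
    intro T hT hTn
    rw [sigmaMat_eq_coeff (isHermitian_bilinMat hT) hkm, abs_mul, abs_pow, abs_neg, abs_one,
      one_pow, one_mul]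
    exact hK _ _ fun i j => (abs_bilinMat_le T i j).trans hTn
  have h1 := hsig _ hs (hA.trans (le_add_of_nonneg_right (sq_nonneg _)))
  have h2 := hsig (fderiv ℝ (fderiv ℝ (gauge ρ)) (θ : E m) +
    (fderiv ℝ (gauge ρ) (θ : E m)).smulRight (fderiv ℝ (gauge ρ) (θ : E m)))
    (fun u v => by simp [hs u v, mul_comm]) (norm_add_smulRight_le hA hp)
  refine ⟨h1, (abs_sub _ _).trans ?_⟩
  linarith

end Bounds

/-! ### Position of Ω relative to the level sets of the gauge -/

section Domain

variable {m : ℕ} {Ω : Set (E m)} {ρ : S m → ℝ}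

theorem IsStarshapedDomain.mem_frontier_iff (h : IsStarshapedDomain Ω ρ) {x : E m} :
    x ∈ frontier Ω ↔ gauge ρ x = 1 := by
  rw [h.frontier_eq]
  constructor
  · rintro ⟨θ, rfl⟩
    rw [gauge_smul (h.pos θ), gauge_sphere, mul_one_div_cancel (h.pos θ).ne']
  · intro hx
    have hx0 : x ≠ 0 := by
      rintro rfl
      simp [gauge] at hx
    obtain ⟨θ, hθ⟩ := exists_smul_sphere hx0
    refine ⟨θ, ?_⟩
    have h1 : ‖x‖ = ρ θ := by
      have h2 := gauge_mul_radialExt h.pos hx0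
      rw [hx, one_mul, hθ, radialExt_smul_sphere (norm_pos_iff.2 hx0), ← hθ] at h2
      exact h2.symm
    change ρ θ • (θ : E m) = x
    rw [← h1]
    exact hθ.symm

/-- Off its frontier, the space splits into the open set and its open exterior. -/
theorem subset_of_isPreconnected_of_disjoint_frontier {X : Type*} [TopologicalSpace X]
    {s t : Set X} (ht : IsPreconnected t) (hst : Disjoint t (frontier s)) (hs : IsOpen s)
    (hne : (t ∩ s).Nonempty) : t ⊆ s := by
  refine ht.subset_left_of_subset_union hs isClosed_closure.isOpen_compl
    (Set.disjoint_compl_right_iff_subset.2 subset_closure) (fun x hx => ?_) hne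
  by_cases hxs : x ∈ closure s
  · by_contra hcon
    refine Set.disjoint_left.1 hst hx ⟨hxs, fun hi => hcon (Or.inl (interior_subset hi))⟩
  · exact Or.inr hxs

theorem IsStarshapedDomain.gauge_le_one (h : IsStarshapedDomain Ω ρ) {x : E m} (hx : x ∈ Ω) :
    gauge ρ x ≤ 1 := by
  by_contra! hg
  have hx0 : x ≠ 0 := by
    rintro rfl
    simp [gauge] at hg
    linarith
  -- The outward ray from x has g > 1, so it never meets Γ and would stay in the bounded set Ω.
  have hsub : (fun t : ℝ => t • x) '' Set.Ici 1 ⊆ Ω := by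
    refine subset_of_isPreconnected_of_disjoint_frontier
      (isPreconnected_Ici.image _ (by fun_prop)) (Set.disjoint_left.2 ?_) h.isOpen
      ⟨x, ⟨1, Set.self_mem_Ici, one_smul _ _⟩, hx⟩
    rintro _ ⟨t, ht, rfl⟩ hf
    have ht1 : (1 : ℝ) ≤ t := ht
    rw [h.mem_frontier_iff, gauge_smul (by linarith)] at hf
    nlinarith
  obtain ⟨C, hC⟩ := h.isBounded.exists_norm_le
  have hxp := norm_pos_iff.2 hx0
  have h1 := hC ((max 1 ((C + 1) / ‖x‖)) • x) (hsub ⟨_, Set.mem_Ici.2 (le_max_left _ _), rfl⟩)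
  rw [norm_smul, Real.norm_of_nonneg (zero_le_one.trans (le_max_left _ _))] at h1
  have h2 := mul_le_mul_of_nonneg_right (le_max_right 1 ((C + 1) / ‖x‖)) hxp.le
  rw [div_mul_cancel₀ _ hxp.ne'] at h2
  linarith

theorem IsStarshapedDomain.mem_of_gauge_lt_one (h : IsStarshapedDomain Ω ρ) {x : E m}
    (hx : gauge ρ x < 1) : x ∈ Ω := by
  have hseg : ∀ y : E m, gauge ρ y < 1 →
      Disjoint ((fun t : ℝ => t • y) '' Set.Icc 0 1) (frontier Ω) := by
    intro y hy
    refine Set.disjoint_left.2 ?_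
    rintro _ ⟨t, ⟨ht0, ht1⟩, rfl⟩ hf
    rw [h.mem_frontier_iff] at hf
    rcases ht0.eq_or_lt with rfl | ht
    · simp [gauge] at hf
    · rw [gauge_smul ht] at hf
      nlinarith
  have hpc : ∀ y : E m, IsPreconnected ((fun t : ℝ => t • y) '' Set.Icc 0 1) := fun y =>
    isPreconnected_Icc.image _ (by fun_prop)
  have hne : Ω.Nonempty := by
    by_contra hcon
    rw [Set.not_nonempty_iff_eq_empty] at hcon
    have : Nonempty (S m) := (NormedSpace.sphere_nonempty.2 zero_le_one).to_subtype
    have hfr := h.frontier_eq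
    rw [hcon, frontier_empty] at hfr
    exact (Set.range_nonempty _).ne_empty hfr.symm
  obtain ⟨y, hy⟩ := hne
  have hy1 : gauge ρ y < 1 := (h.gauge_le_one hy).lt_of_ne fun hy1 =>
    (disjoint_frontier_iff_isOpen.2 h.isOpen).le_bot ⟨h.mem_frontier_iff.2 hy1, hy⟩
  -- The segment from a point of Ω to the origin avoids Γ; the origin then serves as base point for
  -- every x with g < 1.
  have h0 : (0 : E m) ∈ Ω := subset_of_isPreconnected_of_disjoint_frontier (hpc y) (hseg y hy1)
    h.isOpen ⟨y, ⟨1, by simp, one_smul _ _⟩, hy⟩ ⟨0, by simp, zero_smul _ _⟩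
  exact subset_of_isPreconnected_of_disjoint_frontier (hpc x) (hseg x hx)
    h.isOpen ⟨0, ⟨0, by simp, zero_smul _ _⟩, h0⟩ ⟨1, by simp, one_smul _ _⟩

end Domain

/-! ### The minimum of σ_{k-1} of the principal curvatures -/

section MinimumCurvature

variable {m k : ℕ} {ρ : S m → ℝ}

/-- For any admissible κ, σ_{k-1}(κ) is the slope over a positive continuous factor: independent of
the choice of κ and continuous on a compact sphere. -/
theorem exists_isLeast_sigmaVec (hk : 1 ≤ k) (hkm : k ≤ m + 1)
    (hρ : ContMDiff (𝓡 m) 𝓘(ℝ, ℝ) 2 ρ) (hpos : ∀ θ, 0 < ρ θ) (hconv : IsKConvex (k - 1) ρ) :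
    ∃ c₁ : ℝ, 0 < c₁ ∧ IsLeast {s : ℝ | ∃ (θ : S m) (κ : Fin m → ℝ),
      IsPrincipalCurvatures ρ θ κ ∧ s = sigmaVec (k - 1) κ} c₁ := by
  have : Nonempty (S m) := (NormedSpace.sphere_nonempty.2 zero_le_one).to_subtype
  have hp : Continuous fun θ : S m => fderiv ℝ (gauge ρ) (θ : E m) :=
    continuous_iff_continuousAt.2 fun θ =>
      (continuousAt_fderiv (contDiffAt_gauge hρ hpos (sphere_ne_zero θ))).comp
        continuous_subtype_val.continuousAt
  choose κ hκ hκc using hconv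
  have hw : ∀ θ : S m, 0 < ‖fderiv ℝ (gauge ρ) (θ : E m)‖ ^ 2 *
      ((ρ θ * ‖fderiv ℝ (gauge ρ) (θ : E m)‖) ^ (k - 1)) := by
    intro θ
    obtain ⟨-, -, -, -, -, h, -⟩ := (hκ θ).exists_frame hρ hpos
    have h1 : 0 < ‖fderiv ℝ (gauge ρ) (θ : E m)‖ := (one_div_pos.2 (hpos θ)).trans_le h
    have := hpos θ
    positivity
  have hF : ∀ {θ : S m} {κ : Fin m → ℝ}, IsPrincipalCurvatures ρ θ κ →
      sigmaVec (k - 1) κ = sigmaSlope k ρ θ / (‖fderiv ℝ (gauge ρ) (θ : E m)‖ ^ 2 *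
        ((ρ θ * ‖fderiv ℝ (gauge ρ) (θ : E m)‖) ^ (k - 1))) := by
    intro θ κ h
    rw [h.sigmaSlope_eq hk hkm hρ hpos, mul_div_cancel_left₀ _ (hw θ).ne']
  have hcont : Continuous fun θ : S m => sigmaSlope k ρ θ /
      (‖fderiv ℝ (gauge ρ) (θ : E m)‖ ^ 2 *
        ((ρ θ * ‖fderiv ℝ (gauge ρ) (θ : E m)‖) ^ (k - 1))) :=
    (continuous_sigmaSlope hkm hρ hpos).div
      ((hp.norm.pow 2).mul ((hρ.continuous.mul hp.norm).pow _)) fun θ => (hw θ).ne'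
  obtain ⟨θ₀, -, hθ₀⟩ := isCompact_univ.exists_isMinOn Set.univ_nonempty hcont.continuousOn
  refine ⟨sigmaVec (k - 1) (κ θ₀), ?_, ⟨θ₀, κ θ₀, hκ θ₀, rfl⟩, ?_⟩
  -- For k = 1 the cone condition is empty, and positivity comes from σ_0 = 1.
  · rcases Nat.eq_zero_or_pos (k - 1) with h0 | h0
    · simp [h0, sigmaVec, Multiset.esymm, Multiset.powersetCard_zero_left]
    · exact hκc θ₀ (k - 1) h0 le_rfl
  · rintro _ ⟨θ, κ', hκ', rfl⟩
    rw [hF (hκ θ₀), hF hκ']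
    exact hθ₀ (Set.mem_univ θ)

theorem IsPrincipalCurvatures.div_le_mul_sigmaSlope (hk : 1 ≤ k) (hkm : k ≤ m + 1)
    (hρ : ContMDiff (𝓡 m) 𝓘(ℝ, ℝ) 2 ρ) (hpos : ∀ θ, 0 < ρ θ) {θ : S m} {κ : Fin m → ℝ}
    (h : IsPrincipalCurvatures ρ θ κ) {c : ℝ} (hc : 0 ≤ c) (hcκ : c ≤ sigmaVec (k - 1) κ) :
    c / ρ θ ≤ ρ θ * sigmaSlope k ρ θ := by
  obtain ⟨-, -, -, -, -, h1, -⟩ := h.exists_frame hρ hpos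
  rw [h.sigmaSlope_eq hk hkm hρ hpos]
  set q := ‖fderiv ℝ (gauge ρ) (θ : E m)‖
  have hr := hpos θ
  have h2 : 1 ≤ ρ θ * q := by rwa [div_le_iff₀ hr, mul_comm] at h1
  have h3 : 1 ≤ (ρ θ * q) ^ (k - 1) := one_le_pow₀ h2
  have h4 : c ≤ (ρ θ * q) ^ (k - 1) * sigmaVec (k - 1) κ := by nlinarith
  -- After multiplication by ρ, the goal has ρ² |Dg|² on the right, which is the factor (ρ q)² ≥ 1.
  have h5 : c ≤ (ρ θ * q) ^ 2 * ((ρ θ * q) ^ (k - 1) * sigmaVec (k - 1) κ) := by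
    nlinarith [one_le_pow₀ h2 (n := 2)]
  rw [div_le_iff₀ hr]
  calc c ≤ _ := h5
    _ = _ := by ring

end MinimumCurvature

end StarshapedHessian

/-! ### The main theorem -/

open StarshapedHessian in
theorem mainTheorem7 (m k : ℕ) (hm : 1 ≤ m) (hk : 1 ≤ k) (hkm : k ≤ m + 1) :
    ∃ c₀ : ℝ → ℝ → ℝ, (∀ a b, 0 < c₀ a b) ∧
      ∀ (Ω : Set (StarshapedHessian.E m)) (ρ : StarshapedHessian.S m → ℝ),
        StarshapedHessian.IsStarshapedDomain Ω ρ →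
        StarshapedHessian.IsKConvex (k - 1) ρ →
        ∃ c₁ : ℝ, 0 < c₁ ∧
          IsLeast {s : ℝ | ∃ (θ : StarshapedHessian.S m) (κ : Fin m → ℝ),
            StarshapedHessian.IsPrincipalCurvatures ρ θ κ ∧
              s = StarshapedHessian.sigmaVec (k - 1) κ} c₁ ∧
          (∀ N : ℝ, 0 < N →
            ContDiffOn ℝ 2 (StarshapedHessian.phi ρ N) {0}ᶜ ∧
            (∀ x : StarshapedHessian.E m, x ≠ 0 →
              N ^ k * StarshapedHessian.gauge ρ x ^ ((k : ℝ) * N - k) / ‖x‖ ^ k *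
                  (-c₀ (⨅ θ, ρ θ) (StarshapedHessian.c2Norm ρ) +
                    c₁ * (N - 1) / StarshapedHessian.radialExt ρ x) ≤
                StarshapedHessian.sigmaMat k
                  (StarshapedHessian.hessian (StarshapedHessian.phi ρ N) x)) ∧
            (∀ x ∈ frontier Ω, StarshapedHessian.phi ρ N x = 1)) ∧
          (∀ x ∉ Ω, 1 ≤ StarshapedHessian.gauge ρ x) ∧
          (∃ N₀ : ℝ, 0 < N₀ ∧ ∀ N : ℝ, N₀ ≤ N →
            ∀ x ∉ closure Ω,
              1 / ‖x‖ ^ k ≤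
                StarshapedHessian.sigmaMat k
                  (StarshapedHessian.hessian (StarshapedHessian.phi ρ N) x)) := by
  obtain ⟨K, hK0, hK⟩ := exists_sigma_bounds hkm
  have hc₀ : ∀ a b, 0 < K a b + 2 * |b| * K a b + 1 := fun a b => by
    have := hK0 a b
    positivity
  -- `K` bounds |σ_k(D²g)|, 2|b|K bounds ρ times the slope (needed for N < 1), and 1 ensures
  -- positivity. The absolute value keeps the constant positive for all real arguments.
  refine ⟨fun a b => K a b + 2 * |b| * K a b + 1, hc₀, fun Ω ρ hΩ hconv => ?_⟩
  have hρ := hΩ.contMDiff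
  have hpos := hΩ.pos
  obtain ⟨c₁, hc₁, hleast⟩ := exists_isLeast_sigmaVec hk hkm hρ hpos hconv
  set a := ⨅ θ, ρ θ
  set b := c2Norm ρ
  set c₀ := K a b + 2 * |b| * K a b + 1
  have hρb : ∀ θ : S m, ρ θ ≤ b := fun θ => by
    have := le_c2Norm hρ θ
    linarith [le_abs_self (ρ θ), norm_nonneg (fderiv ℝ (radialExt ρ) (θ : E m)),
      ContinuousLinearMap.opNorm_nonneg (fderiv ℝ (fderiv ℝ (radialExt ρ)) (θ : E m))]
  have hineq : ∀ N : ℝ, 0 < N → ∀ x : E m, x ≠ 0 →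
      N ^ k * gauge ρ x ^ ((k : ℝ) * N - k) / ‖x‖ ^ k *
        (-c₀ + c₁ * (N - 1) / radialExt ρ x) ≤ sigmaMat k (hessian (phi ρ N) x) := by
    intro N hN x hx
    obtain ⟨θ, hθ⟩ := exists_smul_sphere hx
    have hr := norm_pos_iff.2 hx
    obtain ⟨κ, hκ, -⟩ := hconv θ
    have hR : radialExt ρ x = ρ θ := by rw [hθ, radialExt_smul_sphere hr]
    have h := sigmaMat_hessian_phi hk hkm hρ hpos hκ hN hr
    rw [← hθ] at h
    have hg := Real.rpow_pos_of_pos (gauge_pos hpos hx) ((k : ℝ) * N - k)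
    rw [h, hR]
    refine mul_le_mul_of_nonneg_left ?_ (by positivity)
    obtain ⟨h1, h2⟩ := hK ρ hρ hpos θ
    have h3 := hκ.div_le_mul_sigmaSlope hk hkm hρ hpos hc₁.le (hleast.2 ⟨θ, κ, hκ, rfl⟩)
    have h4 : 0 < c₁ / ρ θ := div_pos hc₁ (hpos θ)
    have h5 : ρ θ * sigmaSlope k ρ θ ≤ |b| * (2 * K a b) :=
      mul_le_mul ((hρb θ).trans (le_abs_self b)) ((le_abs_self _).trans h2)
        ((pos_iff_pos_of_mul_pos (h4.trans_le h3)).1 (hpos θ)).le (abs_nonneg b)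
    have h6 := neg_abs_le (sigmaMat k (bilinMat (fderiv ℝ (fderiv ℝ (gauge ρ)) (θ : E m))))
    have h7 : 0 ≤ |b| * K a b := mul_nonneg (abs_nonneg b) (hK0 a b)
    rw [show c₁ * (N - 1) / ρ θ = (N - 1) * (c₁ / ρ θ) by ring, mul_assoc (N - 1)]
    rcases le_total 1 N with hN1 | hN1
    · have := mul_le_mul_of_nonneg_left h3 (sub_nonneg.2 hN1)
      simp only [c₀]
      linarith
    -- For N ≤ 1 the deficit is (1 - N) times the nonnegative excess of ρ · slope over c₁/ρ; as 1 -
    -- N ≤ 1, c₀ absorbs it.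
    · have h8 : (1 - N) * (ρ θ * sigmaSlope k ρ θ - c₁ / ρ θ) ≤
          1 * (ρ θ * sigmaSlope k ρ θ - c₁ / ρ θ) :=
        mul_le_mul_of_nonneg_right (by linarith) (by linarith)
      simp only [c₀]
      linarith
  have hge : ∀ x ∉ Ω, 1 ≤ gauge ρ x := fun x hx => by
    by_contra! h
    exact hx (hΩ.mem_of_gauge_lt_one h)
  refine ⟨c₁, hc₁, hleast, fun N hN => ⟨contDiffOn_phi hρ hpos N, hineq N hN, fun x hx => ?_⟩,
    hge, ?_⟩
  · rw [phi, hΩ.mem_frontier_iff.1 hx, Real.one_rpow]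
  · have hc := hc₀ a b
    have hN₀ : 0 ≤ (1 + c₀) * |b| / c₁ := by positivity
    -- Since ρ ≤ |b|, this threshold gives c₁(N - 1)/ρ ≥ 1 + c₀, and the leading 1 gives N ≥ 1, so
    -- the exponent k(N - 1) of g ≥ 1 is nonnegative.
    refine ⟨1 + (1 + c₀) * |b| / c₁, by positivity, fun N hN x hx => ?_⟩
    have hN1 : 1 ≤ N := by linarith
    have hg1 := hge x fun h => hx (subset_closure h)
    have hx0 : x ≠ 0 := by
      rintro rfl
      simp [StarshapedHessian.gauge] at hg1
      linarith
    refine le_trans ?_ (hineq N (by linarith) x hx0)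
    obtain ⟨θ, hθ⟩ := exists_smul_sphere hx0
    have hr := norm_pos_iff.2 hx0
    have hR : radialExt ρ x = ρ θ := by rw [hθ, radialExt_smul_sphere hr]
    have h1 : 1 ≤ -c₀ + c₁ * (N - 1) / radialExt ρ x := by
      have h2 : (1 + c₀) * |b| / c₁ ≤ N - 1 := by linarith
      rw [div_le_iff₀ hc₁] at h2
      have h3 : 1 + c₀ ≤ c₁ * (N - 1) / ρ θ := by
        rw [le_div_iff₀ (hpos θ), mul_comm c₁]
        refine le_trans ?_ h2
        exact mul_le_mul_of_nonneg_left ((hρb θ).trans (le_abs_self b)) (by linarith)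
      rw [hR]
      linarith
    have hk0 : (0 : ℝ) ≤ (k : ℝ) * N - k := by
      nlinarith [(Nat.cast_nonneg k : (0 : ℝ) ≤ k)]
    have h2 : 1 ≤ N ^ k * gauge ρ x ^ ((k : ℝ) * N - k) :=
      one_le_mul_of_one_le_of_one_le (one_le_pow₀ hN1) (Real.one_le_rpow hg1 hk0)
    have h3 : 1 / ‖x‖ ^ k ≤ N ^ k * gauge ρ x ^ ((k : ℝ) * N - k) / ‖x‖ ^ k := by gcongr
    exact h3.trans (le_mul_of_one_le_right (le_trans (by positivity) h3) h1)
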